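/- Let $p$ be a prime and let $R$ be an $F$-finite Noetherian normal domain of characteristic $p$ with fraction field $K$. For a Weil divisor $E$ on $\operatorname{Spec} R$ put $R(E)=H^0(\operatorname{Spec} R,\mathcal O(E))=\{f\in K : f=0 \text{ or } \operatorname{ord}_P(f)\ge -E(P)\text{ for all height one primes }P\}$, and use the analogous notation over other Noetherian normal domains. Let $D$ be a Weil divisor on $\operatorname{Spec} R$ such that the symbolic Rees algebra $S=\bigoplus_{i\ge 0}R(iD)$ is a finitely generated $R$-algebra. Then $S$ is an $F$-finite Noetherian normal domain, and every height one prime of $S$ lies over a prime of $R$ of height at most one (so that Weil divisors on $\operatorname{Spec} R$ have a canonical pullback along $h:\operatorname{Spec} S\to\operatorname{Spec} R$). Let $G$ be an effective Weil divisor on $\operatorname{Spec} R$ with pullback $G_S=h^*G$ on $\operatorname{Spec} S$, and let $e\ge 0$. Then $R(G)\subseteq S(G_S)$ and there is a commutative diagram $$\begin{array}{ccccc} \operatorname{Hom}_S(F^e_*S(G_S),S) & \hookrightarrow & \operatorname{Hom}_S(F^e_*S,S) & \xrightarrow{\ E_S\ } & S\\ {\scriptstyle\nu}\downarrow & & {\scriptstyle\gamma}\downarrow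 & & \downarrow{\scriptstyle\rho}\\ \operatorname{Hom}_R(F^e_*R(G),R) & \hookrightarrow & \operatorname{Hom}_R(F^e_*R,R) & \xrightarrow{\ E_R\ } & R \end{array}$$ of $R$-linear maps. Here the left horizontal maps are restriction along $S\subseteq S(G_S)$ and $R\subseteq R(G)$ and are injective; $E_S$ and $E_R$ are evaluation at $1$; $\rho$ is the projection onto the degree zero part $[S]_0=R$; $\gamma$ sends $\psi$ to its restriction to $F^e_*R=F^e_*[S]_0$ followed by $\rho$; and $\nu$ sends $\psi$ to its restriction to $F^e_*R(G)\subseteq F^e_*S(G_S)$ followed by $\rho$. Furthermore, $\gamma$ and $\nu$ are surjective. -/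

import Mathlib

open Polynomial

noncomputable section

namespace SymbolicRees

/-! ### Weil divisors on the spectrum of a Noetherian normal domain -/

/-- A prime divisor on `Spec R`: a prime ideal of height one. -/
@[ext]
structure PrimeDivisor (R : Type*) [CommRing R] where
  asIdeal : Ideal R
  isPrime : asIdeal.IsPrime
  height_eq_one : asIdeal.height = 1

attribute [instance] PrimeDivisor.isPrime

/-- An (integral) Weil divisor on `Spec R`: a finite formal `ℤ`-linear combination of prime
divisors. It is effective if it is `≥ 0` for the coefficientwise order. -/
abbrev WeilDivisor (R : Type*) [CommRing R] := PrimeDivisor R →₀ ℤ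

section Order

variable {R : Type*} [CommRing R] [IsDomain R]

/-- The local ring of a normal Noetherian domain at a height one prime is a discrete valuation
ring. -/
theorem PrimeDivisor.isDiscreteValuationRing [IsNoetherianRing R] [IsIntegrallyClosed R]
    (P : PrimeDivisor R) : IsDiscreteValuationRing (Localization.AtPrime P.asIdeal) := by
  have hN : IsNoetherianRing (Localization.AtPrime P.asIdeal) :=
    IsLocalization.isNoetherianRing P.asIdeal.primeCompl _ inferInstance
  have hC : IsIntegrallyClosed (Localization.AtPrime P.asIdeal) :=
    isIntegrallyClosed_of_isLocalization _ P.asIdeal.primeCompl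
      P.asIdeal.primeCompl_le_nonZeroDivisors
  have hdim : ringKrullDim (Localization.AtPrime P.asIdeal) = 1 := by
    rw [IsLocalization.AtPrime.ringKrullDim_eq_height P.asIdeal, P.height_eq_one]
    rfl
  have hK : Ring.KrullDimLE 1 (Localization.AtPrime P.asIdeal) := by
    rw [Ring.krullDimLE_iff, hdim]
    rfl
  have hfield : ¬ IsField (Localization.AtPrime P.asIdeal) := by
    intro h
    rw [ringKrullDim_eq_zero_of_isField h] at hdim
    exact zero_ne_one hdim
  have hdim1 := Ring.krullDimLE_one_iff_of_noZeroDivisors.mp hK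
  have : Ring.DimensionLEOne (Localization.AtPrime P.asIdeal) := ⟨fun {p} h0 hp => hdim1 p h0 hp⟩
  have : IsDedekindDomain (Localization.AtPrime P.asIdeal) := { }
  exact ((IsDiscreteValuationRing.TFAE _ hfield).out 0 2).mpr this

theorem PrimeDivisor.ne_bot (P : PrimeDivisor R) : P.asIdeal ≠ ⊥ :=
  Ideal.ne_bot_of_height_eq_one P.height_eq_one

variable (K : Type*) [Field K] [Algebra R K] [IsFractionRing R K]
variable [IsNoetherianRing R] [IsIntegrallyClosed R]

/-- The valuation of the fraction field `K` given by the discrete valuation ring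
`R_P ⊆ K`, written multiplicatively: it takes the value `exp (-n)` on the elements which
vanish to order `n` along `P`. -/
def PrimeDivisor.valuation (P : PrimeDivisor R) : Valuation K (WithZero (Multiplicative ℤ)) :=
  letI : Algebra (Localization.AtPrime P.asIdeal) K :=
    IsLocalization.localizationAlgebraOfSubmonoidLe (Localization.AtPrime P.asIdeal) K
      P.asIdeal.primeCompl (nonZeroDivisors R) P.asIdeal.primeCompl_le_nonZeroDivisors
  haveI : IsScalarTower R (Localization.AtPrime P.asIdeal) K :=
    IsLocalization.localization_isScalarTower_of_submonoid_le _ _ _ _ _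
  haveI : IsFractionRing (Localization.AtPrime P.asIdeal) K :=
    IsFractionRing.isFractionRing_of_isDomain_of_isLocalization P.asIdeal.primeCompl _ _
  haveI := P.isDiscreteValuationRing
  (IsDiscreteValuationRing.maximalIdeal (Localization.AtPrime P.asIdeal)).valuation K

theorem PrimeDivisor.valuation_algebraMap_le_one (P : PrimeDivisor R) (a : R) :
    P.valuation K (algebraMap R K a) ≤ 1 := by
  let _ : Algebra (Localization.AtPrime P.asIdeal) K :=
    IsLocalization.localizationAlgebraOfSubmonoidLe (Localization.AtPrime P.asIdeal) K
      P.asIdeal.primeCompl (nonZeroDivisors R) P.asIdeal.primeCompl_le_nonZeroDivisors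
  have : IsScalarTower R (Localization.AtPrime P.asIdeal) K :=
    IsLocalization.localization_isScalarTower_of_submonoid_le _ _ _ _ _
  have : IsFractionRing (Localization.AtPrime P.asIdeal) K :=
    IsFractionRing.isFractionRing_of_isDomain_of_isLocalization P.asIdeal.primeCompl _ _
  have := P.isDiscreteValuationRing
  rw [IsScalarTower.algebraMap_apply R (Localization.AtPrime P.asIdeal) K]
  exact IsDedekindDomain.HeightOneSpectrum.valuation_le_one _ _

theorem PrimeDivisor.exists_smul_of_valuation_le_one (P : PrimeDivisor R) {f : K}
    (hf : P.valuation K f ≤ 1) : ∃ s ∉ P.asIdeal, ∃ r : R, s • f = algebraMap R K r := by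
  let _ : Algebra (Localization.AtPrime P.asIdeal) K :=
    IsLocalization.localizationAlgebraOfSubmonoidLe (Localization.AtPrime P.asIdeal) K
      P.asIdeal.primeCompl (nonZeroDivisors R) P.asIdeal.primeCompl_le_nonZeroDivisors
  have : IsScalarTower R (Localization.AtPrime P.asIdeal) K :=
    IsLocalization.localization_isScalarTower_of_submonoid_le _ _ _ _ _
  have : IsFractionRing (Localization.AtPrime P.asIdeal) K :=
    IsFractionRing.isFractionRing_of_isDomain_of_isLocalization P.asIdeal.primeCompl _ _
  have := P.isDiscreteValuationRing
  obtain ⟨a, rfl⟩ := IsDiscreteValuationRing.exists_lift_of_le_one hf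
  obtain ⟨⟨r, s⟩, hrs⟩ := IsLocalization.surj P.asIdeal.primeCompl a
  refine ⟨s, s.2, r, ?_⟩
  rw [IsScalarTower.algebraMap_apply R (Localization.AtPrime P.asIdeal) K r, ← hrs,
    Algebra.smul_def, map_mul, mul_comm, ← IsScalarTower.algebraMap_apply]

/-- The fractional ideal `R(D) = H⁰(Spec R, O(D)) ⊆ K`: zero and the rational functions `f` whose
order along every prime divisor `P` is at least `-D(P)`. -/
def fractionalIdeal (D : WeilDivisor R) : Submodule R K where
  carrier := {f | ∀ P : PrimeDivisor R, P.valuation K f ≤ WithZero.exp (D P)}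
  zero_mem' P := by simp
  add_mem' {f g} hf hg P := ((P.valuation K).map_add f g).trans (max_le (hf P) (hg P))
  smul_mem' a f hf P := by
    rw [Algebra.smul_def, map_mul]
    exact (mul_le_of_le_one_left' (P.valuation_algebraMap_le_one K a)).trans (hf P)

variable {K}

theorem mem_fractionalIdeal {D : WeilDivisor R} {f : K} :
    f ∈ fractionalIdeal K D ↔ ∀ P : PrimeDivisor R, P.valuation K f ≤ WithZero.exp (D P) :=
  Iff.rfl

theorem algebraMap_mem_fractionalIdeal {D : WeilDivisor R} (hD : 0 ≤ D) (a : R) :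
    algebraMap R K a ∈ fractionalIdeal K D := fun P =>
  (P.valuation_algebraMap_le_one K a).trans (by
    rw [← WithZero.exp_zero]
    exact WithZero.exp_le_exp.mpr (hD P))

/-- A Noetherian normal domain is the intersection of its localizations at height one primes. -/
theorem exists_of_mem_fractionalIdeal_zero {f : K}
    (hf : f ∈ fractionalIdeal K (0 : WeilDivisor R)) : ∃ r : R, algebraMap R K r = f := by
  by_contra hne
  obtain ⟨a, b, hb, rfl⟩ := IsFractionRing.div_surjective (A := R) f
  have hb0 : b ≠ 0 := nonZeroDivisors.ne_zero hb
  have hbK : algebraMap R K b ≠ 0 := by simpa using hb0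
  have hmem : ∀ c s : R, s ∈ (⊥ : Submodule R (R ⧸ Ideal.span {b})).colon
      {Ideal.Quotient.mk (Ideal.span {b}) c} ↔ ∃ r, s * c = b * r := by
    intro c s
    rw [Submodule.mem_colon_singleton, Submodule.mem_bot]
    change Ideal.Quotient.mk _ (s * c) = 0 ↔ _
    rw [Ideal.Quotient.eq_zero_iff_mem, Ideal.mem_span_singleton]
    rfl
  have hne' : Ideal.Quotient.mk (Ideal.span {b}) a ≠ 0 := by
    intro h
    rw [Ideal.Quotient.eq_zero_iff_mem, Ideal.mem_span_singleton] at h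
    obtain ⟨r, rfl⟩ := h
    exact hne ⟨r, by rw [map_mul]; field_simp⟩
  obtain ⟨Q, hQass, hle⟩ := exists_le_isAssociatedPrime_of_isNoetherianRing R _ hne'
  obtain ⟨hQ, y, hy⟩ := Submodule.isAssociatedPrime_iff.mp hQass
  obtain ⟨c, rfl⟩ := Ideal.Quotient.mk_surjective y
  have hQmem : ∀ s, s ∈ Q ↔ ∃ r, s * c = b * r := fun s => by rw [hy]; exact hmem c s
  have hbQ : b ∈ Q := (hQmem b).mpr ⟨c, rfl⟩
  have hc : ¬ ∃ r, c = b * r := by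
    rintro ⟨r, hr⟩
    exact hQ.ne_top ((Ideal.eq_top_iff_one Q).mpr ((hQmem 1).mpr ⟨r, by rw [one_mul, hr]⟩))
  have hQ0 : Q ≠ ⊥ := fun h => hb0 (by rwa [h, Ideal.mem_bot] at hbQ)
  -- multiplication by `c / b` maps `Q` into `R`, but not into `Q`
  obtain ⟨x, hxQ, u, hxu, huQ⟩ : ∃ x ∈ Q, ∃ u, x * c = b * u ∧ u ∉ Q := by
    by_contra! hcon
    have hint : IsIntegral R (algebraMap R K c / algebraMap R K b) := by
      refine isIntegral_of_smul_mem_submodule (M := K)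
        (Submodule.map (Algebra.linearMap R K) Q) ?_ ?_ _ ?_
      · intro h
        have h0 : algebraMap R K b ∈ Submodule.map (Algebra.linearMap R K) Q := ⟨b, hbQ, rfl⟩
        rw [h, Submodule.mem_bot] at h0
        exact hbK h0
      · exact Submodule.FG.map _ (IsNoetherian.noetherian Q)
      · rintro _ ⟨s, hs, rfl⟩
        obtain ⟨r, hr⟩ := (hQmem s).mp hs
        refine ⟨r, hcon s hs r hr, ?_⟩
        have hr' := congrArg (algebraMap R K) hr
        rw [map_mul, map_mul] at hr'
        rw [Algebra.linearMap_apply, Algebra.linearMap_apply, smul_eq_mul]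
        field_simp
        linear_combination -hr'
    obtain ⟨r, hr⟩ := IsIntegrallyClosed.isIntegral_iff.mp hint
    refine hc ⟨r, IsFractionRing.injective R K ?_⟩
    rw [map_mul, hr]
    field_simp
  have hht : Q.height = 1 := by
    refine le_antisymm ?_ ?_
    · refine Ideal.height_le_one_of_isPrincipal_of_mem_minimalPrimes (Ideal.span {x}) Q
        ⟨⟨hQ, (Ideal.span_singleton_le_iff_mem _).mpr hxQ⟩, ?_⟩
      rintro q ⟨hq, hxq⟩ hqQ s hs
      rw [Ideal.span_singleton_le_iff_mem] at hxq
      obtain ⟨r, hr⟩ := (hQmem s).mp hs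
      have hsu : s * u = x * r := by
        refine mul_left_cancel₀ hb0 ?_
        linear_combination x * hr - s * hxu
      exact (hq.mem_or_mem (hsu ▸ q.mul_mem_right r hxq)).resolve_right fun h => huQ (hqQ h)
    · rw [Order.one_le_iff_ne_zero]
      exact fun h => hQ0 (Ideal.height_eq_zero_iff_eq_bot.mp h)
  obtain ⟨s, hsQ, r, hr⟩ := PrimeDivisor.exists_smul_of_valuation_le_one K ⟨Q, hQ, hht⟩
    (f := algebraMap R K a / algebraMap R K b) (by simpa using hf ⟨Q, hQ, hht⟩)
  refine hsQ (hle ((hmem a s).mpr ⟨r, IsFractionRing.injective R K ?_⟩))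
  rw [map_mul, map_mul, ← hr, Algebra.smul_def]
  field_simp

end Order

/-! ### Pullback of Weil divisors -/

section Pullback

variable {R : Type*} [CommRing R] (T : Type*) [CommRing T] [IsDomain T] [IsNoetherianRing T]
  [Algebra R T] [FaithfulSMul R T]

open scoped Classical in
/-- The coefficient along `Q` of the pullback of `G` to `Spec T`: if `Q` lies over the prime
divisor `P`, it is the coefficient of `G` along `P` times the ramification index (the order
along `Q` of a local equation of `P`). If `Q` does not lie over a prime divisor it is zero: `G` is
trivial near the generic point, and a prime divisor `Q` lying over a prime of height at least two
does not exist when preimages of closed sets of codimension at least two have codimension at least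
two, as is the case for the spectrum of a finitely generated symbolic Rees algebra. -/
def pullbackCoeff (G : WeilDivisor R) (Q : PrimeDivisor T) : ℤ :=
  if h : (Q.asIdeal.under R).height = 1 then
    G ⟨Q.asIdeal.under R, inferInstance, h⟩ * (Q.asIdeal.ramificationIdx R : ℤ)
  else 0

theorem finite_support_pullbackCoeff [IsDomain R] (G : WeilDivisor R) :
    (Function.support (pullbackCoeff T G)).Finite := by
  have hfin : (⋃ P ∈ G.support, ((P.asIdeal.map (algebraMap R T)).minimalPrimes)).Finite :=
    Set.Finite.biUnion G.support.finite_toSet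
      fun P _ => Ideal.finite_minimalPrimes_of_isNoetherianRing T _
  refine Set.Finite.of_finite_image (f := PrimeDivisor.asIdeal) (hfin.subset ?_)
    (fun Q₁ _ Q₂ _ h => PrimeDivisor.ext h)
  rintro _ ⟨Q, hQ, rfl⟩
  rw [Function.mem_support, pullbackCoeff] at hQ
  split_ifs at hQ with h
  · have hG := left_ne_zero_of_mul hQ
    simp only [Set.mem_iUnion]
    refine ⟨_, Finsupp.mem_support_iff.mpr hG, ⟨Q.isPrime, Ideal.map_comap_le⟩, ?_⟩
    rintro q ⟨hq, hle⟩ hqQ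
    by_contra hnot
    have hlt : q < Q.asIdeal := lt_of_le_not_ge hqQ hnot
    have hq0 : q = ⊥ := by
      have h1 := Ideal.height_add_one_le_of_lt_of_isPrime hlt
      rw [Q.height_eq_one] at h1
      refine Ideal.height_eq_zero_iff_eq_bot.mp (nonpos_iff_eq_zero.mp ?_)
      exact (ENat.add_le_add_iff_right ENat.one_ne_top).mp (by simpa using h1)
    subst hq0
    refine Ideal.ne_bot_of_height_eq_one h ?_
    rw [le_bot_iff, Ideal.map_eq_bot_iff_of_injective (FaithfulSMul.algebraMap_injective R T)]
      at hle
    exact hle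
  · exact absurd rfl hQ

/-- The pullback of a Weil divisor on `Spec R` along `Spec T → Spec R`. -/
def pullback [IsDomain R] (G : WeilDivisor R) : WeilDivisor T :=
  Finsupp.ofSupportFinite (pullbackCoeff T G) (finite_support_pullbackCoeff T G)

theorem pullback_nonneg [IsDomain R] {G : WeilDivisor R} (hG : 0 ≤ G) : 0 ≤ pullback T G := by
  intro Q
  change 0 ≤ pullbackCoeff T G Q
  unfold pullbackCoeff
  split_ifs
  · exact mul_nonneg (hG _) (Nat.cast_nonneg _)
  · exact le_rfl

end Pullback

/-! ### Frobenius pushforward -/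

/-- A ring of characteristic `p` is `F`-finite if the Frobenius map is finite. -/
def IsFFinite (p : ℕ) (T : Type*) [CommRing T] [ExpChar T p] : Prop :=
  (frobenius T p).Finite

/-- The `T`-module `F^e_* M`: the abelian group `M` on which `t` acts as `t ^ (p ^ e)`. -/
def FrobPush (_p _e : ℕ) (M : Type*) : Type _ := M

namespace FrobPush

variable {p e : ℕ} {M : Type*} [AddCommGroup M]

instance : AddCommGroup (FrobPush p e M) := inferInstanceAs (AddCommGroup M)

/-- The element `F^e_* x` of `F^e_* M`. -/
def of (p e : ℕ) {M : Type*} [AddCommGroup M] : M ≃+ FrobPush p e M := AddEquiv.refl M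

variable {T : Type*} [CommRing T] [ExpChar T p] [Module T M]

instance : Module T (FrobPush p e M) := Module.compHom M (iterateFrobenius T p e)

theorem smul_of (t : T) (x : M) : t • of p e x = of p e (t ^ p ^ e • x) := rfl

end FrobPush

section Hom

variable (p e : ℕ) {T : Type*} [CommRing T] [ExpChar T p]

/-- Evaluation at one, `Hom_T(F^e_* T, T) → T`. -/
def evalOne : (FrobPush p e T →ₗ[T] T) →ₗ[T] T :=
  LinearMap.applyₗ (FrobPush.of p e (1 : T))

variable [IsDomain T] [IsNoetherianRing T] [IsIntegrallyClosed T]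
  (L : Type*) [Field L] [Algebra T L] [IsFractionRing T L]

/-- For effective `E`, the inclusion `F^e_* T → F^e_* T(E)`. -/
def inclusion {E : WeilDivisor T} (hE : 0 ≤ E) :
    FrobPush p e T →ₗ[T] FrobPush p e (fractionalIdeal L E) where
  toFun x := FrobPush.of p e
    ⟨algebraMap T L ((FrobPush.of p e).symm x), algebraMap_mem_fractionalIdeal hE _⟩
  map_add' x y := by
    rw [← map_add]
    congr 1
    ext
    simp
  map_smul' t x := by
    obtain ⟨x, rfl⟩ := (FrobPush.of p e).surjective x
    rw [FrobPush.smul_of, RingHom.id_apply, FrobPush.smul_of]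
    congr 1
    ext
    simp [Algebra.smul_def]

/-- For effective `E`, the map `Hom_T(F^e_* T(E), T) → Hom_T(F^e_* T, T)` induced by
`T ⊆ T(E)`. -/
def restrict {E : WeilDivisor T} (hE : 0 ≤ E) :
    (FrobPush p e (fractionalIdeal L E) →ₗ[T] T) →ₗ[T] (FrobPush p e T →ₗ[T] T) :=
  LinearMap.lcomp T T (inclusion p e L hE)

end Hom

/-! ### The symbolic Rees algebra -/

section Rees

variable {R : Type*} [CommRing R] [IsDomain R] [IsNoetherianRing R] [IsIntegrallyClosed R]
  (K : Type*) [Field K] [Algebra R K] [IsFractionRing R K] (D : WeilDivisor R)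

/-- The symbolic Rees algebra `R ⊕ R(D) ⊕ R(2D) ⊕ ⋯`, where the summand `R(iD) ⊆ K` of degree `i`
is placed as `R(iD) X ^ i` in the polynomial ring `K[X]`. -/
def reesAlgebra : Subalgebra R K[X] where
  carrier := {f | ∀ i : ℕ, f.coeff i ∈ fractionalIdeal K (i • D)}
  add_mem' {f g} hf hg i := by
    rw [coeff_add]
    exact add_mem (hf i) (hg i)
  mul_mem' {f g} hf hg n := by
    rw [coeff_mul]
    refine sum_mem fun ij hij P => ?_
    rw [map_mul, ← Finset.HasAntidiagonal.mem_antidiagonal.mp hij, add_smul, Finsupp.add_apply, WithZero.exp_add]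
    exact mul_le_mul' (hf _ P) (hg _ P)
  algebraMap_mem' r i := by
    rw [Polynomial.algebraMap_apply, coeff_C]
    split_ifs with h
    · subst h
      rw [zero_smul]
      exact algebraMap_mem_fractionalIdeal le_rfl r
    · exact zero_mem _

instance (p : ℕ) [ExpChar R p] : ExpChar (reesAlgebra K D) p :=
  expChar_of_injective_algebraMap (FaithfulSMul.algebraMap_injective R _) p

/-- The projection `ρ` of the symbolic Rees algebra onto its degree zero part `R`. -/
def degreeZero : reesAlgebra K D →ₐ[R] R :=
  ((Algebra.botEquivOfInjective (FaithfulSMul.algebraMap_injective R K)) :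
      (⊥ : Subalgebra R K) →ₐ[R] R).comp
    ((((aeval (0 : K)).restrictScalars R).comp (reesAlgebra K D).val).codRestrict ⊥ (by
      intro f
      have h := f.2 0
      rw [zero_smul] at h
      obtain ⟨r, hr⟩ := exists_of_mem_fractionalIdeal_zero h
      rw [Algebra.mem_bot]
      refine ⟨r, hr.trans ?_⟩
      simp [coeff_zero_eq_eval_zero]))

theorem algebraMap_degreeZero (f : reesAlgebra K D) :
    algebraMap R K (degreeZero K D f) = (f : K[X]).coeff 0 := by
  have h : ∀ x : (⊥ : Subalgebra R K), algebraMap R K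
      (Algebra.botEquivOfInjective (FaithfulSMul.algebraMap_injective R K) x) = x := by
    intro x
    obtain ⟨r, rfl⟩ :=
      (Algebra.botEquivOfInjective (FaithfulSMul.algebraMap_injective R K)).symm.surjective x
    rw [AlgEquiv.apply_symm_apply]
    rfl
  refine (h _).trans ?_
  simp [coeff_zero_eq_eval_zero]

/-- The map `γ : Hom_S(F^e_* S, S) → Hom_R(F^e_* R, R)`, where `S` is the symbolic Rees algebra:
restrict to the degree zero part `F^e_* R` of `F^e_* S`, then project onto the degree zero part
`R` of `S`. -/
def gamma (p e : ℕ) [ExpChar R p] :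
    (FrobPush p e (reesAlgebra K D) →ₗ[reesAlgebra K D] reesAlgebra K D) →ₗ[R]
      (FrobPush p e R →ₗ[R] R) where
  toFun ψ :=
    { toFun := fun x => degreeZero K D
        (ψ (FrobPush.of p e (algebraMap R (reesAlgebra K D) ((FrobPush.of p e).symm x))))
      map_add' := fun x y => by simp only [map_add]
      map_smul' := fun r x => by
        obtain ⟨x, rfl⟩ := (FrobPush.of p e).surjective x
        have h : FrobPush.of p e (algebraMap R (reesAlgebra K D) (r ^ p ^ e • x)) =
            algebraMap R (reesAlgebra K D) r •
              FrobPush.of p e (algebraMap R (reesAlgebra K D) x) := by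
          rw [FrobPush.smul_of, smul_eq_mul, smul_eq_mul, map_mul, map_pow]
        rw [FrobPush.smul_of, AddEquiv.symm_apply_apply, AddEquiv.symm_apply_apply, h,
          map_smul, smul_eq_mul, map_mul, AlgHom.commutes]
        rfl }
  map_add' ψ₁ ψ₂ := by
    ext x
    simp
  map_smul' r ψ := by
    ext x
    simp

end Rees

end SymbolicRees

end

open Polynomial

noncomputable section

namespace SymbolicRees

/-! ### Orders along prime divisors -/

namespace PrimeDivisor

/-! Everything happens inside `K[X]`, where `S` consists of the polynomials whose degree `i`
coefficient lies in `R(iD)`. Membership is thus a condition at each height one prime separately.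

Normality of `S` is checked prime by prime: replacing `X` by `uX` with `ord_P(u) = D(P)` carries `S`
into `V[X]`, where `V` is the valuation ring of `P` in `K` (`mem_reesAlgebra_of_isIntegral`). For
height one primes (`height_under_le_one`), if `Q` lay over `q` of height at least two, a function
with a simple pole along `Q` and no other pole would be multiplied into `S` by `q`. It would then
lie in `S`, because `q` is contained in no height one prime of `R`.

For surjectivity put `q = p^e`. A map `φ` on `F^e_* R(G)` extends to an additive `Φ : K → K` with
`Φ(c^q x) = c Φ(x)`, and this semilinearity gives `Φ(R(G + qiD)) ⊆ R(iD)`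
(`apply_mem_fractionalIdeal`). The elements of `S(h^*G)` are polynomials with degree `i` coefficient
in `R(G + iD)` (`exists_linearMap_polynomial`). Hence `cX^(qi) ↦ Φ(c)X^i`, with all other monomials
sent to zero, maps `F^e_* S(h^*G)` to `S` and induces `φ` in degree zero. The case `G = 0` handles
`γ`. -/

theorem eq_of_le {R : Type*} [CommRing R] {P Q : PrimeDivisor R}
    (h : P.asIdeal ≤ Q.asIdeal) : P = Q := by
  refine PrimeDivisor.ext (by_contra fun hne => ?_)
  have h1 := Ideal.height_add_one_le_of_lt_of_isPrime (lt_of_le_of_ne h hne)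
  rw [P.height_eq_one, Q.height_eq_one] at h1
  exact absurd h1 (by norm_num)

theorem mem_minimalPrimes {R : Type*} [CommRing R] [IsDomain R] (P : PrimeDivisor R)
    {a : R} (ha : a ≠ 0) (haP : a ∈ P.asIdeal) :
    P.asIdeal ∈ (Ideal.span {a}).minimalPrimes := by
  refine ⟨⟨P.isPrime, (Ideal.span_singleton_le_iff_mem _).mpr haP⟩, ?_⟩
  rintro q ⟨hq, haq⟩ hqP
  by_contra hnot
  have h1 := Ideal.height_add_one_le_of_lt_of_isPrime (lt_of_le_not_ge hqP hnot)
  rw [P.height_eq_one] at h1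
  have h0 : q = ⊥ := Ideal.height_eq_zero_iff_eq_bot.mp (nonpos_iff_eq_zero.mp
    ((ENat.add_le_add_iff_right ENat.one_ne_top).mp (by simpa using h1)))
  rw [Ideal.span_singleton_le_iff_mem, h0, Ideal.mem_bot] at haq
  exact ha haq

theorem finite_setOf_mem {R : Type*} [CommRing R] [IsDomain R] [IsNoetherianRing R]
    {a : R} (ha : a ≠ 0) : {P : PrimeDivisor R | a ∈ P.asIdeal}.Finite := by
  refine Set.Finite.of_finite_image (f := PrimeDivisor.asIdeal)
    ((Ideal.finite_minimalPrimes_of_isNoetherianRing R (Ideal.span {a})).subset ?_)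
    (fun P _ Q _ h => PrimeDivisor.ext h)
  rintro _ ⟨P, hP, rfl⟩
  exact P.mem_minimalPrimes ha hP

variable {R : Type*} [CommRing R] [IsDomain R] [IsNoetherianRing R] [IsIntegrallyClosed R]
  {K : Type*} [Field K] [Algebra R K] [IsFractionRing R K]

theorem valuation_algebraMap_eq_intValuation (P : PrimeDivisor R) (a : R) :
    haveI := P.isDiscreteValuationRing
    P.valuation K (algebraMap R K a) =
      (IsDiscreteValuationRing.maximalIdeal (Localization.AtPrime P.asIdeal)).intValuation
        (algebraMap R _ a) := by
  let _ : Algebra (Localization.AtPrime P.asIdeal) K :=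
    IsLocalization.localizationAlgebraOfSubmonoidLe (Localization.AtPrime P.asIdeal) K
      P.asIdeal.primeCompl (nonZeroDivisors R) P.asIdeal.primeCompl_le_nonZeroDivisors
  have : IsScalarTower R (Localization.AtPrime P.asIdeal) K :=
    IsLocalization.localization_isScalarTower_of_submonoid_le _ _ _ _ _
  have : IsFractionRing (Localization.AtPrime P.asIdeal) K :=
    IsFractionRing.isFractionRing_of_isDomain_of_isLocalization P.asIdeal.primeCompl _ _
  have := P.isDiscreteValuationRing
  rw [IsScalarTower.algebraMap_apply R (Localization.AtPrime P.asIdeal) K]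
  exact IsDedekindDomain.HeightOneSpectrum.valuation_of_algebraMap _ _

theorem valuation_algebraMap_eq_one_iff (P : PrimeDivisor R) {a : R} :
    P.valuation K (algebraMap R K a) = 1 ↔ a ∉ P.asIdeal := by
  have := P.isDiscreteValuationRing
  rw [valuation_algebraMap_eq_intValuation,
    IsDedekindDomain.HeightOneSpectrum.intValuation_eq_one_iff]
  exact not_congr (IsLocalization.AtPrime.to_map_mem_maximal_iff _ P.asIdeal a)

theorem valuation_algebraMap_le_exp_neg (P : PrimeDivisor R) {a : R} {n : ℕ}
    (ha : a ∈ P.asIdeal ^ n) : P.valuation K (algebraMap R K a) ≤ WithZero.exp (-(n : ℤ)) := by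
  have := P.isDiscreteValuationRing
  rw [valuation_algebraMap_eq_intValuation,
    IsDedekindDomain.HeightOneSpectrum.intValuation_le_pow_iff_mem]
  have h := Ideal.mem_map_of_mem (algebraMap R (Localization.AtPrime P.asIdeal)) ha
  rwa [Ideal.map_pow, Localization.AtPrime.map_eq_maximalIdeal] at h

variable (K) in
theorem exists_uniformizer (P : PrimeDivisor R) :
    ∃ a : R, P.valuation K (algebraMap R K a) = WithZero.exp (-1) := by
  obtain ⟨x, hx⟩ : ∃ x : K, P.valuation K x = WithZero.exp (-1) := by
    let _ : Algebra (Localization.AtPrime P.asIdeal) K :=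
      IsLocalization.localizationAlgebraOfSubmonoidLe (Localization.AtPrime P.asIdeal) K
        P.asIdeal.primeCompl (nonZeroDivisors R) P.asIdeal.primeCompl_le_nonZeroDivisors
    have : IsScalarTower R (Localization.AtPrime P.asIdeal) K :=
      IsLocalization.localization_isScalarTower_of_submonoid_le _ _ _ _ _
    have : IsFractionRing (Localization.AtPrime P.asIdeal) K :=
      IsFractionRing.isFractionRing_of_isDomain_of_isLocalization P.asIdeal.primeCompl _ _
    have := P.isDiscreteValuationRing
    exact IsDedekindDomain.HeightOneSpectrum.valuation_exists_uniformizer K _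
  obtain ⟨s, hs, r, hr⟩ := P.exists_smul_of_valuation_le_one K (f := x) (by
    rw [hx, ← WithZero.exp_zero]
    exact WithZero.exp_le_exp.mpr (by norm_num))
  refine ⟨r, ?_⟩
  rw [← hr, Algebra.smul_def, map_mul, P.valuation_algebraMap_eq_one_iff.mpr hs, hx, one_mul]

theorem finite_setOf_valuation_ne_one {f : K} (hf : f ≠ 0) :
    {P : PrimeDivisor R | P.valuation K f ≠ 1}.Finite := by
  obtain ⟨a, b, hb, rfl⟩ := IsFractionRing.div_surjective (A := R) f
  have ha : a ≠ 0 := by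
    rintro rfl
    simp at hf
  refine ((finite_setOf_mem ha).union (finite_setOf_mem (nonZeroDivisors.ne_zero hb))).subset ?_
  intro P hP
  by_contra hnot
  rw [Set.mem_union, not_or] at hnot
  refine hP ?_
  rw [map_div₀, P.valuation_algebraMap_eq_one_iff.mpr hnot.1,
    P.valuation_algebraMap_eq_one_iff.mpr hnot.2, div_one]

/-- Avoiding a prime ideal while vanishing to high order along finitely many prime divisors. -/
theorem exists_notMem_valuation_le (I : Ideal R) [I.IsPrime] (s : Finset (PrimeDivisor R))
    (hs : ∀ P ∈ s, ¬ P.asIdeal ≤ I) (N : PrimeDivisor R → ℕ) :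
    ∃ c ∉ I, ∀ P ∈ s, P.valuation K (algebraMap R K c) ≤ WithZero.exp (-(N P : ℤ)) := by
  have hnot : ¬ (∏ P ∈ s, P.asIdeal ^ N P) ≤ I := by
    rw [Ideal.IsPrime.prod_le ‹_›]
    rintro ⟨P, hP, hle⟩
    exact hs P hP (Ideal.IsPrime.le_of_pow_le hle)
  obtain ⟨c, hc, hcI⟩ := SetLike.not_le_iff_exists.mp hnot
  exact ⟨c, hcI, fun P hP => P.valuation_algebraMap_le_exp_neg
    (Ideal.le_of_dvd (Finset.dvd_prod_of_mem _ hP) hc)⟩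

end PrimeDivisor

/-! ### Testing membership in `R(E)` one prime divisor at a time -/

section FractionalIdeal

variable {R : Type*} [CommRing R] [IsDomain R] [IsNoetherianRing R] [IsIntegrallyClosed R]
  (K : Type*) [Field K] [Algebra R K] [IsFractionRing R K]

theorem exists_ne_zero_mem_fractionalIdeal (E : WeilDivisor R) :
    ∃ a : R, a ≠ 0 ∧ algebraMap R K a ∈ fractionalIdeal K E := by
  obtain ⟨c, hc, hcE⟩ := PrimeDivisor.exists_notMem_valuation_le (K := K) (⊥ : Ideal R) E.support
    (fun P _ h => P.ne_bot (le_bot_iff.mp h)) (fun P => (E P).natAbs)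
  refine ⟨c, hc, fun P => ?_⟩
  by_cases hP : P ∈ E.support
  · exact (hcE P hP).trans (WithZero.exp_le_exp.mpr (by omega))
  · rw [Finsupp.notMem_support_iff.mp hP, WithZero.exp_zero]
    exact P.valuation_algebraMap_le_one K c

/-- The bound defining `R(E)` is attained at each `P`. A power of a uniformizer has the right order
at `P` and can violate the bound only at finitely many other primes; a factor `c ∉ P` vanishing
there to high order repairs this. -/
theorem exists_mem_fractionalIdeal_valuation_eq (E : WeilDivisor R) (P : PrimeDivisor R) :
    ∃ f ∈ fractionalIdeal K E, P.valuation K f = WithZero.exp (E P) := by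
  classical
  obtain ⟨a, ha⟩ := P.exists_uniformizer K
  set f : K := (algebraMap R K a) ^ (-E P) with hf
  have hfP : P.valuation K f = WithZero.exp (E P) := by
    rw [hf, map_zpow₀, ha, ← WithZero.exp_zsmul]
    simp
  have hf0 : f ≠ 0 := by
    intro h
    rw [h, map_zero] at hfP
    exact WithZero.exp_ne_zero hfP.symm
  set s := ((PrimeDivisor.finite_setOf_valuation_ne_one (R := R) hf0).toFinset ∪ E.support).erase P
    with hsdef
  obtain ⟨c, hc, hcs⟩ := PrimeDivisor.exists_notMem_valuation_le (K := K) P.asIdeal s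
    (fun Q hQ h => (Finset.mem_erase.mp hQ).1 (PrimeDivisor.eq_of_le h))
    (fun Q => (E Q - WithZero.log (Q.valuation K f)).natAbs)
  refine ⟨algebraMap R K c * f, fun Q => ?_, ?_⟩
  · rw [map_mul]
    by_cases hQP : Q = P
    · rw [hQP, hfP]
      exact mul_le_of_le_one_left' (P.valuation_algebraMap_le_one K c)
    · by_cases hQ : Q ∈ s
      · rw [← WithZero.exp_log ((Q.valuation K).ne_zero_iff.mpr hf0)]
        refine (mul_le_mul_left (hcs Q hQ) _).trans ?_
        rw [← WithZero.exp_add]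
        exact WithZero.exp_le_exp.mpr (by omega)
      · rw [hsdef, Finset.mem_erase, Finset.mem_union, Set.Finite.mem_toFinset] at hQ
        push Not at hQ
        obtain ⟨h1, h2⟩ := hQ hQP
        rw [Finsupp.notMem_support_iff.mp h2, WithZero.exp_zero,
          show Q.valuation K f = 1 by simpa using h1, mul_one]
        exact Q.valuation_algebraMap_le_one K c
  · rw [map_mul, hfP, P.valuation_algebraMap_eq_one_iff.mpr hc, one_mul]

variable {K}

theorem mul_mem_fractionalIdeal {D E : WeilDivisor R} {f g : K} (hf : f ∈ fractionalIdeal K D)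
    (hg : g ∈ fractionalIdeal K E) : f * g ∈ fractionalIdeal K (D + E) := fun P => by
  rw [map_mul, Finsupp.add_apply, WithZero.exp_add]
  exact mul_le_mul' (hf P) (hg P)

/-- Membership in `R(D + E)` can be tested by multiplying with `R(-E)`. -/
theorem mem_fractionalIdeal_of_forall_mul_mem {D E : WeilDivisor R} {f : K}
    (h : ∀ g ∈ fractionalIdeal K (-E), g * f ∈ fractionalIdeal K D) :
    f ∈ fractionalIdeal K (D + E) := fun P => by
  obtain ⟨g, hg, hgP⟩ := exists_mem_fractionalIdeal_valuation_eq K (-E) P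
  have h1 := h g hg P
  rw [map_mul, hgP, Finsupp.neg_apply] at h1
  have h2 := mul_le_mul_right h1 (WithZero.exp (E P))
  rwa [← mul_assoc, ← WithZero.exp_add, add_neg_cancel, WithZero.exp_zero, one_mul,
    ← WithZero.exp_add, add_comm] at h2

end FractionalIdeal

/-! ### Orders and pullback -/

section Pullback

variable {R : Type*} [CommRing R] [IsDomain R] [IsNoetherianRing R] [IsIntegrallyClosed R]
  {K : Type*} [Field K] [Algebra R K] [IsFractionRing R K]

/-- `P` is generated by `a` after inverting elements outside `P`, and these become units in `T_Q`
because `Q` lies over `P`. -/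
theorem PrimeDivisor.map_eq_span_uniformizer {T : Type*} [CommRing T] [Algebra R T]
    (P : PrimeDivisor R) (Q : PrimeDivisor T)
    (h : Q.asIdeal.under R = P.asIdeal) {a : R}
    (ha : P.valuation K (algebraMap R K a) = WithZero.exp (-1)) :
    P.asIdeal.map (algebraMap R (Localization.AtPrime Q.asIdeal)) =
      Ideal.span {algebraMap R (Localization.AtPrime Q.asIdeal) a} := by
  have haP : a ∈ P.asIdeal := by
    by_contra hnot
    rw [P.valuation_algebraMap_eq_one_iff.mpr hnot, ← WithZero.exp_zero] at ha
    exact absurd (WithZero.exp_injective ha) (by norm_num)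
  refine le_antisymm (Ideal.map_le_iff_le_comap.mpr fun b hb => ?_)
    ((Ideal.span_singleton_le_iff_mem _).mpr (Ideal.mem_map_of_mem _ haP))
  have haK : algebraMap R K a ≠ 0 := by
    intro h0
    rw [h0, map_zero] at ha
    exact WithZero.exp_ne_zero ha.symm
  obtain ⟨s, hs, r, hr⟩ := P.exists_smul_of_valuation_le_one K
    (f := algebraMap R K b / algebraMap R K a) (by
      have hb1 : P.valuation K (algebraMap R K b) ≤ WithZero.exp (-1) := by
        simpa using P.valuation_algebraMap_le_exp_neg (K := K) (n := 1) (by simpa using hb)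
      rw [map_div₀, ha]
      exact div_le_one_of_le₀ hb1 zero_le)
  have hsr : s * b = a * r := by
    refine IsFractionRing.injective R K ?_
    rw [map_mul, map_mul, ← hr, Algebra.smul_def]
    field_simp
  have hsu : IsUnit (algebraMap R (Localization.AtPrime Q.asIdeal) s) := by
    rw [IsScalarTower.algebraMap_apply R T]
    refine IsLocalization.map_units _ (⟨algebraMap R T s, fun hsQ => hs ?_⟩ :
      Q.asIdeal.primeCompl)
    rw [← h]
    exact hsQ
  rw [Ideal.mem_comap, Ideal.mem_span_singleton, ← hsu.dvd_mul_left, ← map_mul, hsr, map_mul]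
  exact dvd_mul_right _ _

variable {T : Type*} [CommRing T] [IsDomain T] [IsNoetherianRing T] [IsIntegrallyClosed T]
  {L : Type*} [Field L] [Algebra T L] [IsFractionRing T L] [Algebra R T] [FaithfulSMul R T]

/-- `ramificationIdx` is the length of `T_Q / P T_Q`. In the discrete valuation ring `T_Q` one has
`P T_Q = (a) = m^n`, so both the length and the order of `a` are `n`. -/
theorem PrimeDivisor.valuation_uniformizer_eq_ramificationIdx (P : PrimeDivisor R)
    (Q : PrimeDivisor T) (h : Q.asIdeal.under R = P.asIdeal) {a : R}
    (ha : P.valuation K (algebraMap R K a) = WithZero.exp (-1)) :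
    Q.valuation L (algebraMap T L (algebraMap R T a)) =
      WithZero.exp (-(Q.asIdeal.ramificationIdx R : ℤ)) := by
  have := Q.isDiscreteValuationRing
  have hspan := P.map_eq_span_uniformizer Q h ha
  have ha0 : a ≠ 0 := by
    rintro rfl
    rw [map_zero, map_zero] at ha
    exact WithZero.exp_ne_zero ha.symm
  have haA : algebraMap T (Localization.AtPrime Q.asIdeal) (algebraMap R T a) ≠ 0 := by
    rwa [Ne, map_eq_zero_iff _ (IsLocalization.injective _
      Q.asIdeal.primeCompl_le_nonZeroDivisors),
      map_eq_zero_iff _ (FaithfulSMul.algebraMap_injective R T)]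
  rw [IsScalarTower.algebraMap_apply R T] at hspan
  obtain ⟨n, hn⟩ := exists_maximalIdeal_pow_eq_of_principal (Localization.AtPrime Q.asIdeal)
    (IsPrincipalIdealRing.principal _)
    (P.asIdeal.map (algebraMap R (Localization.AtPrime Q.asIdeal))) (by
      rwa [hspan, Ne, Ideal.span_singleton_eq_bot])
  have hram : Q.asIdeal.ramificationIdx R = n := by
    rw [Ideal.ramificationIdx_def, h, hn,
      IsDiscreteValuationRing.length_quotient_pow_maximalIdeal, ENat.toNat_natCast]
  rw [valuation_algebraMap_eq_intValuation,
    IsDedekindDomain.HeightOneSpectrum.intValuation_if_neg _ haA, ← hspan, hn, hram]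
  have hirr := (IsDiscreteValuationRing.maximalIdeal
    (Localization.AtPrime Q.asIdeal)).associates_irreducible
  change WithZero.exp (-((Associates.mk (IsDiscreteValuationRing.maximalIdeal
    (Localization.AtPrime Q.asIdeal)).asIdeal).count (Associates.mk
    ((IsDiscreteValuationRing.maximalIdeal
    (Localization.AtPrime Q.asIdeal)).asIdeal ^ n)).factors : ℤ)) = _
  rw [Associates.mk_pow, Associates.count_pow hirr.ne_zero hirr, Associates.count_self hirr,
    mul_one]

/-- The order along `Q` of a rational function on `Spec R` is its order along the prime divisor
below `Q` times the ramification index. -/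
theorem PrimeDivisor.valuation_map (P : PrimeDivisor R) (Q : PrimeDivisor T)
    (h : Q.asIdeal.under R = P.asIdeal) {x : K} {n : ℤ} (hx : P.valuation K x = WithZero.exp n) :
    Q.valuation L (IsFractionRing.map (L := L) (FaithfulSMul.algebraMap_injective R T) x) =
      WithZero.exp (n * (Q.asIdeal.ramificationIdx R : ℤ)) := by
  obtain ⟨a, ha⟩ := P.exists_uniformizer K
  have haK : algebraMap R K a ≠ 0 := by
    intro h0
    rw [h0, map_zero] at ha
    exact WithZero.exp_ne_zero ha.symm
  -- `x` has order `-n` along `P`, so `x a^n` is a quotient `r / s` with `r, s ∉ P`, and these stay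
  -- units at `Q`.
  have hunit : P.valuation K (x * algebraMap R K a ^ n) = 1 := by
    rw [map_mul, map_zpow₀, ha, hx, ← WithZero.exp_zsmul, ← WithZero.exp_add]
    simp
  obtain ⟨s, hs, r, hr⟩ := P.exists_smul_of_valuation_le_one K hunit.le
  have hrP : r ∉ P.asIdeal := by
    rw [← P.valuation_algebraMap_eq_one_iff (K := K), ← hr, Algebra.smul_def, map_mul, hunit,
      P.valuation_algebraMap_eq_one_iff.mpr hs, mul_one]
  have hone : ∀ b ∉ P.asIdeal, Q.valuation L (algebraMap T L (algebraMap R T b)) = 1 := by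
    intro b hb
    rw [Q.valuation_algebraMap_eq_one_iff]
    intro hbQ
    rw [← h] at hb
    exact hb hbQ
  have hr' := congrArg
    (fun y => Q.valuation L (IsFractionRing.map (L := L)
      (FaithfulSMul.algebraMap_injective R T) y)) hr
  simp only [Algebra.smul_def, map_mul, map_zpow₀, IsFractionRing.map, IsLocalization.map_eq]
    at hr'
  rw [hone s hs, hone r hrP, P.valuation_uniformizer_eq_ramificationIdx Q h ha, one_mul] at hr'
  rw [IsFractionRing.map, eq_div_of_mul_eq (zpow_ne_zero _ WithZero.exp_ne_zero) hr',
    ← WithZero.exp_zsmul, one_div, ← WithZero.exp_neg]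
  simp

theorem map_mem_fractionalIdeal_pullback
    (hht : ∀ Q : PrimeDivisor T, (Q.asIdeal.under R).height ≤ 1) {G : WeilDivisor R} {x : K}
    (hx : x ∈ fractionalIdeal K G) :
    IsFractionRing.map (L := L) (FaithfulSMul.algebraMap_injective R T) x ∈
      fractionalIdeal L (pullback T G) := by
  intro Q
  by_cases hx0 : x = 0
  · simp [hx0]
  change _ ≤ WithZero.exp (pullbackCoeff T G Q)
  unfold pullbackCoeff
  split_ifs with h
  · set P : PrimeDivisor R := ⟨Q.asIdeal.under R, inferInstance, h⟩
    have hv := WithZero.exp_log ((P.valuation K).ne_zero_iff.mpr hx0)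
    have hxP := hx P
    rw [← hv, WithZero.exp_le_exp] at hxP
    rw [P.valuation_map Q rfl hv.symm]
    exact WithZero.exp_le_exp.mpr (mul_le_mul_of_nonneg_right hxP (Nat.cast_nonneg _))
  -- If `Q` contracts to zero, denominators from `R` are units at `Q`, so `x` has no pole there.
  · have hbot : Q.asIdeal.under R = ⊥ :=
      Ideal.height_eq_zero_iff_eq_bot.mp (Order.lt_one_iff.mp (lt_of_le_of_ne (hht Q) h))
    obtain ⟨a, b, hb, rfl⟩ := IsFractionRing.div_surjective (A := R) x
    have hbQ : algebraMap R T b ∉ Q.asIdeal := by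
      intro hmem
      have : b ∈ Q.asIdeal.under R := hmem
      rw [hbot] at this
      exact nonZeroDivisors.ne_zero hb this
    simp only [map_div₀, IsFractionRing.map, IsLocalization.map_eq]
    rw [Q.valuation_algebraMap_eq_one_iff.mpr hbQ, div_one, WithZero.exp_zero]
    exact Q.valuation_algebraMap_le_one L _

end Pullback

/-! ### Finiteness and normality of the symbolic Rees algebra -/

/-- Frobenius on `T` is always integral. It is of finite type because its composite with `R → T` is
the finite Frobenius of `R` followed by `R → T`; integral and of finite type together give finite.
-/
theorem IsFFinite.of_finiteType {R T : Type*} [CommRing R] [CommRing T] [Algebra R T] {p : ℕ}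
    [ExpChar R p] [ExpChar T p] (hF : IsFFinite p R) [hT : Algebra.FiniteType R T] :
    IsFFinite p T := by
  refine RingHom.IsIntegral.to_finite (fun x => ?_) ?_
  · refine ⟨X ^ p - C x, monic_X_pow_sub_C x (expChar_pos T p).ne', ?_⟩
    simp [frobenius_def]
  · refine RingHom.FiniteType.of_comp_finiteType (f := algebraMap R T) ?_
    have h : (frobenius T p).comp (algebraMap R T) = (algebraMap R T).comp (frobenius R p) := by
      ext x
      simp [frobenius_def]
    rw [h]
    exact RingHom.FiniteType.comp (RingHom.finiteType_algebraMap.mpr hT)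
      (RingHom.FiniteType.of_finite hF)

section Normal

variable {R : Type*} [CommRing R] [IsDomain R] [IsNoetherianRing R] [IsIntegrallyClosed R]
  {K : Type*} [Field K] [Algebra R K] [IsFractionRing R K] {D : WeilDivisor R}

/-- After rescaling the variable, the symbolic Rees algebra has coefficients in the valuation ring
of any given prime divisor. -/
theorem valuation_coeff_mul_pow_le_one {P : PrimeDivisor R} {u : K}
    (hu : P.valuation K u = WithZero.exp (-D P)) (f : K[X]) (i : ℕ) :
    P.valuation K (f.coeff i * u ^ i) ≤ 1 ↔
      P.valuation K (f.coeff i) ≤ WithZero.exp ((i • D) P) := by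
  rw [map_mul, map_pow, hu, ← WithZero.exp_nsmul, Finsupp.smul_apply, smul_neg, WithZero.exp_neg,
    mul_inv_le_iff₀ (WithZero.exp_pos), one_mul]

/-- The substitution `σ : X ↦ uX` turns integrality over `S` into integrality over `V[X]`. This is
integrality over `V` of each coefficient, and valuation rings are integrally closed. -/
theorem mem_reesAlgebra_of_isIntegral {f : K[X]} (hf : IsIntegral (reesAlgebra K D) f) :
    f ∈ reesAlgebra K D := by
  intro i P
  obtain ⟨u, -, hu⟩ := exists_mem_fractionalIdeal_valuation_eq K (-D) P
  rw [Finsupp.neg_apply] at hu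
  rw [← valuation_coeff_mul_pow_le_one hu]
  let V := (P.valuation K).integer
  let _ : Algebra V[X] K[X] := Polynomial.algebra V K
  let σ : K[X] →+* K[X] := compRingHom (C u * X)
  have hσ : ∀ g i, (σ g).coeff i = g.coeff i * u ^ i := fun g i => comp_C_mul_X_coeff
  let ι : V[X] →+* K[X] := mapRingHom V.subtype
  have hι : Function.Injective ι := map_injective _ Subtype.val_injective
  have hmem : ∀ g : reesAlgebra K D, σ g ∈ ι.range := by
    intro g
    rw [RingHom.mem_range]
    refine (mem_lifts _).mp ((lifts_iff_coeff_lifts _).mpr fun i => ?_)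
    rw [hσ]
    exact ⟨⟨_, (valuation_coeff_mul_pow_le_one hu _ _).mpr (g.2 i P)⟩, rfl⟩
  -- `σ` on `S`, factored through the copy `ι(V[X])` of `V[X]` in `K[X]`.
  let φ : reesAlgebra K D →+* V[X] :=
    (RingEquiv.ofBijective ι.rangeRestrict
      ⟨fun x y h => hι (congrArg Subtype.val h), ι.rangeRestrict_surjective⟩).symm.toRingHom.comp
      ((σ.comp (reesAlgebra K D).val.toRingHom).codRestrict ι.range hmem)
  have hφ : (algebraMap V[X] K[X]).comp φ = σ.comp (algebraMap (reesAlgebra K D) K[X]) := by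
    ext1 g
    have h := (RingEquiv.ofBijective ι.rangeRestrict
      ⟨fun x y h => hι (congrArg Subtype.val h), ι.rangeRestrict_surjective⟩).apply_symm_apply
      ⟨σ g, hmem g⟩
    exact congrArg Subtype.val h
  have hint := isIntegral_iff_isIntegral_coeff.mp (IsIntegral.map_of_comp_eq φ σ hφ hf) i
  rw [hσ] at hint
  exact (Valuation.Integers.mem_of_integral (Valuation.integer.integers (P.valuation K)) hint)

variable (K D) in
-- `K[X]` is normal, so an integral element of `Frac S` becomes a polynomial in `Frac K[X]`. It then
-- suffices that `S` is integrally closed in `K[X]`.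
theorem isIntegrallyClosed_reesAlgebra : IsIntegrallyClosed (reesAlgebra K D) := by
  rw [isIntegrallyClosed_iff (FractionRing (reesAlgebra K D))]
  intro x hx
  let j : reesAlgebra K D →+* K[X] := algebraMap (reesAlgebra K D) K[X]
  have hj : Function.Injective j := Subtype.val_injective
  let θ : FractionRing (reesAlgebra K D) →+* FractionRing K[X] :=
    IsFractionRing.map (K := FractionRing (reesAlgebra K D)) (L := FractionRing K[X]) hj
  have hθ : ∀ s, θ (algebraMap _ _ s) = algebraMap K[X] _ (j s) := fun s => by
    simp [θ, IsFractionRing.map]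
  have hxθ : IsIntegral K[X] (θ x) :=
    IsIntegral.map_of_comp_eq j θ (RingHom.ext fun s => (hθ s).symm) hx
  obtain ⟨f, hf⟩ := IsIntegrallyClosed.isIntegral_iff.mp hxθ
  have hfS : IsIntegral (reesAlgebra K D) f := by
    obtain ⟨P, hP, h0⟩ := hx
    refine ⟨P, hP, IsFractionRing.injective K[X] (FractionRing K[X]) ?_⟩
    have h1 := congrArg θ h0
    rw [map_zero, hom_eval₂] at h1
    rw [map_zero, hom_eval₂, hf, ← h1]
    congr 1
    exact RingHom.ext fun s => (hθ s).symm
  refine ⟨⟨f, mem_reesAlgebra_of_isIntegral hfS⟩, θ.injective ?_⟩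
  rw [hθ, ← hf]
  rfl

end Normal

/-! ### Height one primes of the symbolic Rees algebra -/

section Height

variable {R : Type*} [CommRing R] [IsDomain R] [IsNoetherianRing R] [IsIntegrallyClosed R]
  {K : Type*} [Field K] [Algebra R K] [IsFractionRing R K] {D : WeilDivisor R}

/-- No `P` of height one contains `q`, so some `a ∈ q` is a unit at `P` and multiplying by it does
not change orders along `P`. -/
theorem mem_reesAlgebra_of_forall_smul_mem {q : Ideal R} [q.IsPrime] (hq : 1 < q.height)
    {f : K[X]} (hf : ∀ a ∈ q, a • f ∈ reesAlgebra K D) : f ∈ reesAlgebra K D := by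
  intro i P
  obtain ⟨a, haq, haP⟩ : ∃ a ∈ q, a ∉ P.asIdeal := by
    by_contra! hle
    have h := Ideal.height_mono (I := q) (J := P.asIdeal) hle
    rw [P.height_eq_one] at h
    exact absurd h (not_le.mpr hq)
  have h := hf a haq i P
  rwa [coeff_smul, Algebra.smul_def, map_mul, P.valuation_algebraMap_eq_one_iff.mpr haP,
    one_mul] at h

theorem height_under_le_one [IsNoetherianRing (reesAlgebra K D)]
    [IsIntegrallyClosed (reesAlgebra K D)] (Q : PrimeDivisor (reesAlgebra K D)) :
    (Q.asIdeal.under R).height ≤ 1 := by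
  by_contra! hht
  let L := FractionRing (reesAlgebra K D)
  -- `g` has a simple pole along `Q` and no other pole, so `Q g ⊆ S` although `g ∉ S`.
  obtain ⟨g, hg, hgQ⟩ := exists_mem_fractionalIdeal_valuation_eq L (Finsupp.single Q 1) Q
  have hmul : ∀ s ∈ Q.asIdeal, ∃ t : reesAlgebra K D, algebraMap _ L t = algebraMap _ L s * g := by
    intro s hs
    have hs' : algebraMap _ L s ∈ fractionalIdeal L (-Finsupp.single Q 1) := by
      intro Q'
      by_cases h : Q = Q'
      · subst h
        simpa using Q.valuation_algebraMap_le_exp_neg (K := L) (n := 1) (by simpa using hs)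
      · rw [Finsupp.neg_apply, Finsupp.single_eq_of_ne' h, neg_zero, WithZero.exp_zero]
        exact Q'.valuation_algebraMap_le_one L s
    have h := mul_mem_fractionalIdeal hs' hg
    rw [neg_add_cancel] at h
    exact exists_of_mem_fractionalIdeal_zero h
  obtain ⟨a, ha, ha0⟩ : ∃ a ∈ Q.asIdeal.under R, a ≠ 0 := by
    refine Submodule.exists_mem_ne_zero_of_ne_bot fun hbot => ?_
    rw [Ideal.height_eq_zero_iff_eq_bot.mpr hbot] at hht
    exact absurd hht (by simp)
  have haK : algebraMap R K a ≠ 0 := by simpa using ha0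
  obtain ⟨s, hs⟩ := hmul _ ha
  -- As `s = a g`, this polynomial is `g` itself viewed in `K[X]`; its multiples by elements of `Q ∩
  -- R` lie in `S`.
  have hf : C (algebraMap R K a)⁻¹ * (s : K[X]) ∈ reesAlgebra K D := by
    refine mem_reesAlgebra_of_forall_smul_mem hht fun b hb => ?_
    obtain ⟨t, ht⟩ := hmul _ hb
    have hst : algebraMap R (reesAlgebra K D) b * s = algebraMap R (reesAlgebra K D) a * t := by
      refine IsFractionRing.injective (reesAlgebra K D) L ?_
      rw [map_mul, map_mul, hs, ht]
      ring
    have hst' : C (algebraMap R K b) * (s : K[X]) = C (algebraMap R K a) * (t : K[X]) :=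
      congrArg Subtype.val hst
    have : b • (C (algebraMap R K a)⁻¹ * (s : K[X])) = t := by
      rw [Algebra.smul_def, Polynomial.algebraMap_apply, mul_left_comm, hst', ← mul_assoc, ← C_mul,
        inv_mul_cancel₀ haK, C_1, one_mul]
    rw [this]
    exact t.2
  have hsa : algebraMap R (reesAlgebra K D) a * ⟨_, hf⟩ = s := by
    refine Subtype.ext ?_
    change C (algebraMap R K a) * (C (algebraMap R K a)⁻¹ * (s : K[X])) = s
    rw [← mul_assoc, ← C_mul, mul_inv_cancel₀ haK, C_1, one_mul]
  have haL : algebraMap _ L (algebraMap R (reesAlgebra K D) a) ≠ 0 := by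
    rwa [Ne, map_eq_zero_iff _ (IsFractionRing.injective _ L),
      map_eq_zero_iff _ (FaithfulSMul.algebraMap_injective R _)]
  rw [← hsa, map_mul] at hs
  have hle := Q.valuation_algebraMap_le_one L ⟨_, hf⟩
  rw [mul_left_cancel₀ haL hs, hgQ, Finsupp.single_eq_same, ← WithZero.exp_zero,
    WithZero.exp_le_exp] at hle
  exact absurd hle (by norm_num)

end Height

/-! ### Maps which are linear over the Frobenius -/

section Extension

variable {R : Type*} [CommRing R] [IsDomain R] {K : Type*} [Field K] [Algebra R K]
  [IsFractionRing R K] {p e : ℕ} [ExpChar R p]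
  {M : Type*} [AddCommGroup M] [Module R M]

/-- A map `F^e_* M → R` on an `R`-submodule `M ⊆ K` containing `1` extends to `F^e_* K → K`. -/
theorem exists_extension_to_fractionField (ι : M →ₗ[R] K) (hι : Function.Injective ι)
    {m₀ : M} (hm₀ : ι m₀ = 1) (φ : FrobPush p e M →ₗ[R] R) :
    ∃ Φ : K →+ K, (∀ c x, Φ (c ^ p ^ e * x) = c * Φ x) ∧
      ∀ m, Φ (ι m) = algebraMap R K (φ (FrobPush.of p e m)) := by
  have hq : p ^ e ≠ 0 := pow_ne_zero _ (expChar_pos R p).ne'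
  have hsmul : ∀ (r : R) (m : M), φ (FrobPush.of p e (r ^ p ^ e • m)) =
      r * φ (FrobPush.of p e m) := fun r m => by
    rw [← FrobPush.smul_of, map_smul, smul_eq_mul]
  -- For `x = b / a` one has `a^q x = a^(q-1) b ∈ R ⊆ M`, using `1 ∈ M`. Semilinearity then forces
  -- `Φ(x) = φ(a^q x) / a`.
  have hden : ∀ x : K, ∃ (a : R) (m : M), a ≠ 0 ∧ ι m = algebraMap R K a ^ p ^ e * x := by
    intro x
    obtain ⟨b, a, ha, rfl⟩ := IsFractionRing.div_surjective (A := R) x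
    have ha0 : a ≠ 0 := nonZeroDivisors.ne_zero ha
    have haK : algebraMap R K a ≠ 0 := by simpa using ha0
    refine ⟨a, (a ^ (p ^ e - 1) * b) • m₀, ha0, ?_⟩
    rw [map_smul, hm₀, Algebra.smul_def, mul_one, map_mul, map_pow,
      ← pow_sub_one_mul hq (algebraMap R K a)]
    field_simp
  choose a m ha hm using hden
  have haK : ∀ x, algebraMap R K (a x) ≠ 0 := fun x => by simpa using ha x
  let Φ : K → K := fun x => algebraMap R K (φ (FrobPush.of p e (m x))) / algebraMap R K (a x)
  -- The value of `Φ` does not depend on the chosen denominator; additivity and semilinearity follow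
  -- by picking convenient ones.
  have hΦ : ∀ {x : K} {b : R} {n : M}, ι n = algebraMap R K b ^ p ^ e * x →
      algebraMap R K b * Φ x = algebraMap R K (φ (FrobPush.of p e n)) := by
    intro x b n hn
    have h : a x ^ p ^ e • n = b ^ p ^ e • m x := hι (by
      rw [map_smul, map_smul, hn, hm, Algebra.smul_def, Algebra.smul_def, map_pow, map_pow]
      ring)
    have h' := congrArg (fun n => algebraMap R K (φ (FrobPush.of p e n))) h
    simp only [hsmul, map_mul] at h'
    change _ * (_ / _) = _
    rw [← mul_div_assoc, ← h', mul_div_cancel_left₀ _ (haK x)]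
  have hadd : ∀ x y, Φ (x + y) = Φ x + Φ y := by
    intro x y
    have h : ι (a y ^ p ^ e • m x + a x ^ p ^ e • m y) =
        algebraMap R K (a x * a y) ^ p ^ e * (x + y) := by
      rw [map_add, map_smul, map_smul, hm, hm, Algebra.smul_def, Algebra.smul_def, map_pow,
        map_pow, map_mul]
      ring
    have h1 := hΦ h
    rw [map_add, map_add, hsmul, hsmul, map_add, map_mul, map_mul, map_mul, ← hΦ (hm x),
      ← hΦ (hm y)] at h1
    refine mul_left_cancel₀ (mul_ne_zero (haK x) (haK y)) ?_
    linear_combination h1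
  refine ⟨AddMonoidHom.mk' Φ hadd, fun c x => ?_, fun n => ?_⟩
  · obtain ⟨b, d, hd, rfl⟩ := IsFractionRing.div_surjective (A := R) c
    have hdK : algebraMap R K d ≠ 0 := by simpa using nonZeroDivisors.ne_zero hd
    have h : ι (b ^ p ^ e • m x) = algebraMap R K (a x * d) ^ p ^ e *
        ((algebraMap R K b / algebraMap R K d) ^ p ^ e * x) := by
      rw [map_smul, hm, Algebra.smul_def, map_pow, map_mul, div_pow, mul_pow]
      field_simp
    have h1 := hΦ h
    rw [hsmul, map_mul, map_mul, ← hΦ (hm x)] at h1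
    change Φ _ = _ * Φ _
    refine mul_left_cancel₀ (mul_ne_zero (haK x) hdK) ?_
    rw [h1]
    field_simp
  · have h := hΦ (x := ι n) (b := 1) (n := n) (by simp)
    rwa [map_one, one_mul] at h

end Extension

/-! ### Extending a `p^(-e)`-linear map from `K` to `K[X]` -/

section Contract

variable {K : Type*} [Field K]

theorem coeff_sum_monomial_contract (Φ : K →+ K) {q : ℕ} (hq : q ≠ 0) (f : K[X]) (n : ℕ) :
    (∑ j ∈ Finset.range (f.natDegree + 1), monomial j (Φ ((contract q f).coeff j))).coeff n =
      Φ (f.coeff (n * q)) := by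
  simp only [finsetSum_coeff, coeff_monomial, Finset.sum_ite_eq', Finset.mem_range,
    coeff_contract hq]
  split_ifs with hn
  · rfl
  -- Outside the summation range `n > natDegree f`, hence `n q > natDegree f` as `q ≥ 1`.
  · rw [coeff_eq_zero_of_natDegree_lt, map_zero]
    exact (not_lt.mp hn).trans (Nat.le_mul_of_pos_right n (Nat.pos_of_ne_zero hq))

/-- The additive map which sends `c X ^ (j q)` to `Φ(c) X ^ j` and the monomials whose degree is not
divisible by `q` to zero. -/
def contractMap (Φ : K →+ K) (q : ℕ) (hq : q ≠ 0) : K[X] →+ K[X] :=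
  AddMonoidHom.mk'
    (fun f => ∑ j ∈ Finset.range (f.natDegree + 1), monomial j (Φ ((contract q f).coeff j)))
    (fun f g => Polynomial.ext fun n => by
      simp only [coeff_add, coeff_sum_monomial_contract Φ hq, map_add])

theorem coeff_contractMap (Φ : K →+ K) {q : ℕ} (hq : q ≠ 0) (f : K[X]) (n : ℕ) :
    (contractMap Φ q hq f).coeff n = Φ (f.coeff (n * q)) :=
  coeff_sum_monomial_contract Φ hq f n

/-- `g^q` is `g` with coefficients raised to the power `q` and `X` replaced by `X^q`. Contraction
undoes the latter and semilinearity of `Φ` the former. -/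
theorem contractMap_pow_mul {p e : ℕ} [ExpChar K p] {Φ : K →+ K}
    (hΦ : ∀ c x, Φ (c ^ p ^ e * x) = c * Φ x) (hq : p ^ e ≠ 0) (f g : K[X]) :
    contractMap Φ (p ^ e) hq (g ^ p ^ e * f) = g * contractMap Φ (p ^ e) hq f := by
  ext n
  rw [coeff_contractMap, ← coeff_contract hq, ← map_iterateFrobenius_expand, map_expand, mul_comm,
    contract_mul_expand hq, mul_comm, coeff_mul, coeff_mul, map_sum]
  refine Finset.sum_congr rfl fun ij _ => ?_
  rw [coeff_map, iterateFrobenius_def, hΦ, coeff_contractMap, coeff_contract hq]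

end Contract

/-! ### Maps into `S` built from `Φ`, and surjectivity of `γ` -/

section Surjective

variable {R : Type*} [CommRing R] [IsDomain R] [IsNoetherianRing R] [IsIntegrallyClosed R]
  {K : Type*} [Field K] [Algebra R K] [IsFractionRing R K]
  {p e : ℕ}

/-- For `g ∈ R(-D)` one has `g Φ(x) = Φ(g^q x)` with `g^q x ∈ R(G)`, so `R(-D) Φ(x) ⊆ R`. -/
theorem apply_mem_fractionalIdeal {Φ : K →+ K} (hΦ : ∀ c x, Φ (c ^ p ^ e * x) = c * Φ x)
    {G : WeilDivisor R}
    (hΦG : ∀ x ∈ fractionalIdeal K G, Φ x ∈ fractionalIdeal K (0 : WeilDivisor R))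
    {D : WeilDivisor R} {x : K} (hx : x ∈ fractionalIdeal K (G + p ^ e • D)) :
    Φ x ∈ fractionalIdeal K D := by
  rw [← zero_add D]
  refine mem_fractionalIdeal_of_forall_mul_mem fun g hg => ?_
  rw [← hΦ]
  refine hΦG _ fun P => ?_
  have h1 : P.valuation K (g ^ p ^ e) ≤ WithZero.exp (p ^ e • (-D) P) := by
    rw [map_pow, WithZero.exp_nsmul]
    exact pow_le_pow_left' (hg P) _
  rw [map_mul]
  refine (mul_le_mul' h1 (hx P)).trans (le_of_eq ?_)
  rw [← WithZero.exp_add]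
  congr 1
  simp

variable [ExpChar R p] {D : WeilDivisor R} {N : Type*} [AddCommGroup N] [Module (reesAlgebra K D) N]

/-- Given an `S`-module `N` of polynomials whose coefficients of degree `i` are in `R(G + iD)`, a
map `F^e_* K → K` sending `F^e_* R(G)` to `R` induces an `S`-linear map `F^e_* N → S`. -/
theorem exists_linearMap_reesAlgebra {Φ : K →+ K} (hΦ : ∀ c x, Φ (c ^ p ^ e * x) = c * Φ x)
    {G : WeilDivisor R}
    (hΦG : ∀ x ∈ fractionalIdeal K G, Φ x ∈ fractionalIdeal K (0 : WeilDivisor R))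
    (τ : N →ₗ[reesAlgebra K D] K[X])
    (hτ : ∀ n i, (τ n).coeff i ∈ fractionalIdeal K (G + i • D)) :
    ∃ ψ : FrobPush p e N →ₗ[reesAlgebra K D] reesAlgebra K D,
      ∀ n, algebraMap R K (degreeZero K D (ψ (FrobPush.of p e n))) = Φ ((τ n).coeff 0) := by
  have : ExpChar K p := expChar_of_injective_algebraMap (FaithfulSMul.algebraMap_injective R K) p
  have hq : p ^ e ≠ 0 := pow_ne_zero _ (expChar_pos R p).ne'
  have hmem : ∀ n, contractMap Φ (p ^ e) hq (τ n) ∈ reesAlgebra K D := by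
    intro n j
    rw [coeff_contractMap]
    refine apply_mem_fractionalIdeal hΦ hΦG ?_
    -- The degree `j` coefficient comes from degree `j q`, where poles along `G + q(jD)` are
    -- allowed.
    rw [← mul_smul, mul_comm]
    exact hτ n _
  refine ⟨{
    toFun := fun n => ⟨contractMap Φ (p ^ e) hq (τ ((FrobPush.of p e).symm n)), hmem _⟩
    map_add' := fun m n => Subtype.ext (by simp)
    map_smul' := fun s n => Subtype.ext ?_ }, fun n => ?_⟩
  · obtain ⟨n, rfl⟩ := (FrobPush.of p e).surjective n
    rw [FrobPush.smul_of, AddEquiv.symm_apply_apply, AddEquiv.symm_apply_apply]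
    have h : τ (s ^ p ^ e • n) = (s : K[X]) ^ p ^ e * τ n := by
      rw [map_smul, Algebra.smul_def, map_pow]
      rfl
    change contractMap Φ (p ^ e) hq (τ (s ^ p ^ e • n)) = s * contractMap Φ (p ^ e) hq (τ n)
    rw [h, contractMap_pow_mul hΦ hq]
  · rw [algebraMap_degreeZero]
    change (contractMap Φ (p ^ e) hq (τ n)).coeff 0 = _
    rw [coeff_contractMap, zero_mul]

theorem gamma_surjective : Function.Surjective (gamma K D p e) := by
  intro φ
  obtain ⟨Φ, hΦ, hφ⟩ := exists_extension_to_fractionField (Algebra.linearMap R K)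
    (IsFractionRing.injective R K) (m₀ := 1) (map_one (algebraMap R K)) φ
  obtain ⟨ψ, hψ⟩ := exists_linearMap_reesAlgebra (D := D) (G := 0) hΦ (fun x hx => by
      obtain ⟨r, rfl⟩ := exists_of_mem_fractionalIdeal_zero hx
      have h := hφ r
      rw [Algebra.linearMap_apply] at h
      rw [h]
      exact algebraMap_mem_fractionalIdeal le_rfl _)
    (Algebra.linearMap (reesAlgebra K D) K[X]) (fun n i => by
      rw [zero_add]
      exact n.2 i)
  refine ⟨ψ, LinearMap.ext fun x => IsFractionRing.injective R K ?_⟩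
  obtain ⟨x, rfl⟩ := (FrobPush.of p e).surjective x
  refine (hψ _).trans (Eq.trans ?_ (hφ x))
  congr 1
  change (C (algebraMap R K x)).coeff 0 = _
  rw [coeff_C_zero, Algebra.linearMap_apply]

end Surjective

/-! ### Rational functions with poles along a pulled back divisor -/

section Pullback

variable {R : Type*} [CommRing R] [IsDomain R] [IsNoetherianRing R] [IsIntegrallyClosed R]
  {K : Type*} [Field K] [Algebra R K] [IsFractionRing R K] {D : WeilDivisor R}
  {L : Type*} [Field L] [Algebra (reesAlgebra K D) L] [IsFractionRing (reesAlgebra K D) L]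
  [IsNoetherianRing (reesAlgebra K D)] [IsIntegrallyClosed (reesAlgebra K D)]

/-- Pullback is additive, so the zeros of `g` along `h^*G` cancel the poles of `y`. -/
theorem exists_algebraMap_eq_map_mul {G : WeilDivisor R} {g : K}
    (hg : g ∈ fractionalIdeal K (-G)) {y : L}
    (hy : y ∈ fractionalIdeal L (pullback (reesAlgebra K D) G)) :
    ∃ s : reesAlgebra K D, algebraMap _ L s =
      IsFractionRing.map (L := L) (FaithfulSMul.algebraMap_injective R (reesAlgebra K D)) g * y := by
  refine exists_of_mem_fractionalIdeal_zero ?_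
  have h := mul_mem_fractionalIdeal
    (map_mem_fractionalIdeal_pullback (L := L) (T := reesAlgebra K D) height_under_le_one hg) hy
  have h0 : pullback (reesAlgebra K D) (-G) + pullback (reesAlgebra K D) G = 0 := by
    ext Q
    change pullbackCoeff _ (-G) Q + pullbackCoeff _ G Q = 0
    unfold pullbackCoeff
    split_ifs <;> simp
  rwa [h0] at h

variable (K D L) in
/-- Elements of `S(h^*G)` are polynomials whose coefficients of degree `i` are in `R(G + iD)`. -/
theorem exists_linearMap_polynomial (G : WeilDivisor R) :
    ∃ τ : fractionalIdeal L (pullback (reesAlgebra K D) G) →ₗ[reesAlgebra K D] K[X],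
      (∀ y i, (τ y).coeff i ∈ fractionalIdeal K (G + i • D)) ∧
      ∀ x ∈ fractionalIdeal K G, ∀ y : fractionalIdeal L (pullback (reesAlgebra K D) G),
        (y : L) = IsFractionRing.map (L := L)
          (FaithfulSMul.algebraMap_injective R (reesAlgebra K D)) x → τ y = C x := by
  -- A single nonzero `a ∈ R(-G)` carries all of `S(h^*G)` into `S`, so `τ y = a⁻¹ (a y)` makes
  -- sense in `K[X]`.
  obtain ⟨a, ha0, ha⟩ := exists_ne_zero_mem_fractionalIdeal K (-G)
  have haK : algebraMap R K a ≠ 0 := by simpa using ha0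
  have haL : algebraMap _ L (algebraMap R (reesAlgebra K D) a) ≠ 0 := by
    rwa [Ne, map_eq_zero_iff _ (IsFractionRing.injective _ L),
      map_eq_zero_iff _ (FaithfulSMul.algebraMap_injective R _)]
  choose s hs using fun y : fractionalIdeal L (pullback (reesAlgebra K D) G) =>
    exists_algebraMap_eq_map_mul ha y.2
  have hinj := IsFractionRing.injective (reesAlgebra K D) L
  let σ : fractionalIdeal L (pullback (reesAlgebra K D) G) →ₗ[reesAlgebra K D] reesAlgebra K D :=
    { toFun := s
      map_add' := fun y z => hinj (by
        rw [map_add, hs, hs, hs, Submodule.coe_add, mul_add])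
      map_smul' := fun t y => hinj (by
        rw [RingHom.id_apply, smul_eq_mul, map_mul, hs, hs, Submodule.coe_smul, Algebra.smul_def]
        ring) }
  let τ := ((Algebra.linearMap (reesAlgebra K D) K[X]).comp σ)
  let μ : K[X] →ₗ[reesAlgebra K D] K[X] := LinearMap.mulLeft _ (C (algebraMap R K a)⁻¹)
  have hC : ∀ y, μ (τ y) = C (algebraMap R K a)⁻¹ * (s y : K[X]) := fun y => rfl
  refine ⟨μ.comp τ, fun y i => ?_, fun x hx y hy => ?_⟩
  · rw [LinearMap.comp_apply, hC, add_comm]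
    -- For every `g ∈ R(-G)` the product `g y` is some `t ∈ S`, whose degree `i` coefficient lies in
    -- `R(iD)`.
    refine mem_fractionalIdeal_of_forall_mul_mem fun g hg => ?_
    obtain ⟨t, ht⟩ := exists_algebraMap_eq_map_mul hg y.2
    obtain ⟨b, c, hc, rfl⟩ := IsFractionRing.div_surjective (A := R) g
    have hcK : algebraMap R K c ≠ 0 := by simpa using nonZeroDivisors.ne_zero hc
    have hcL : algebraMap _ L (algebraMap R (reesAlgebra K D) c) ≠ 0 := by
      rw [Ne, map_eq_zero_iff _ hinj, map_eq_zero_iff _ (FaithfulSMul.algebraMap_injective R _)]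
      exact nonZeroDivisors.ne_zero hc
    have hst : algebraMap R (reesAlgebra K D) b * s y =
        algebraMap R (reesAlgebra K D) (a * c) * t := by
      refine hinj ?_
      rw [map_mul, map_mul, map_mul, map_mul, hs, ht]
      simp only [map_div₀, IsFractionRing.map, IsLocalization.map_eq]
      field_simp
    have hst' : C (algebraMap R K b) * (s y : K[X]) = C (algebraMap R K (a * c)) * (t : K[X]) :=
      congrArg Subtype.val hst
    have hst'' := congrArg (fun f => coeff f i) hst'
    rw [coeff_C_mul, coeff_C_mul, map_mul] at hst''
    have hgt : algebraMap R K b / algebraMap R K c *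
        (C (algebraMap R K a)⁻¹ * (s y : K[X])).coeff i = (t : K[X]).coeff i := by
      rw [coeff_C_mul]
      field_simp
      linear_combination hst''
    rw [hgt]
    exact t.2 i
  · rw [LinearMap.comp_apply, hC]
    have hax := mul_mem_fractionalIdeal ha hx
    rw [neg_add_cancel] at hax
    obtain ⟨r, hr⟩ := exists_of_mem_fractionalIdeal_zero hax
    have hsr : s y = algebraMap R (reesAlgebra K D) r := by
      refine hinj ?_
      rw [hs, hy, ← map_mul, ← hr, IsFractionRing.map, IsLocalization.map_eq]
    rw [hsr]
    change _ * C (algebraMap R K r) = _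
    rw [hr, ← C_mul, ← mul_assoc, inv_mul_cancel₀ haK, one_mul]

end Pullback

/-! ### Injectivity of restriction -/

/-- For `x = b / a` in `T(E)`, `a • F^e_* x = F^e_*(a^(q-1) b)` already lies in `F^e_* T`. A map
vanishing on `F^e_* T` thus satisfies `a φ(x) = 0` in a domain. -/
theorem restrict_injective {T : Type*} [CommRing T] [IsDomain T] [IsNoetherianRing T]
    [IsIntegrallyClosed T] (p e : ℕ) [ExpChar T p] (L : Type*) [Field L] [Algebra T L]
    [IsFractionRing T L] {E : WeilDivisor T} (hE : 0 ≤ E) :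
    Function.Injective (restrict p e L hE) := by
  rw [injective_iff_map_eq_zero]
  intro φ hφ
  have hq : p ^ e ≠ 0 := pow_ne_zero _ (expChar_pos T p).ne'
  refine LinearMap.ext fun x => ?_
  obtain ⟨x, rfl⟩ := (FrobPush.of p e).surjective x
  obtain ⟨b, a, ha, hx⟩ := IsFractionRing.div_surjective (A := T) (x : L)
  have ha0 : a ≠ 0 := nonZeroDivisors.ne_zero ha
  have haL : algebraMap T L a ≠ 0 := by simpa using ha0
  have h : a • FrobPush.of p e x =
      inclusion p e L hE (FrobPush.of p e (a ^ (p ^ e - 1) * b)) := by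
    rw [FrobPush.smul_of]
    refine congrArg (FrobPush.of p e) (Subtype.ext ?_)
    rw [Submodule.coe_smul, ← hx, Algebra.smul_def, map_pow, ← pow_sub_one_mul hq]
    change _ = algebraMap T L (a ^ (p ^ e - 1) * b)
    rw [map_mul, map_pow]
    field_simp
  have h1 : φ (a • FrobPush.of p e x) = 0 := by
    rw [h]
    exact LinearMap.congr_fun hφ _
  rw [map_smul, smul_eq_mul] at h1
  exact (mul_eq_zero.mp h1).resolve_left ha0

/-! ### The map on functions with poles along a pulled back divisor -/

section Nu

variable {R : Type*} [CommRing R] [IsDomain R] [IsNoetherianRing R] [IsIntegrallyClosed R]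
  {K : Type*} [Field K] [Algebra R K] [IsFractionRing R K]
  {T : Type*} [CommRing T] [IsDomain T] [IsNoetherianRing T] [IsIntegrallyClosed T]
  (L : Type*) [Field L] [Algebra T L] [IsFractionRing T L] [Algebra R T] [FaithfulSMul R T]
  (hht : ∀ Q : PrimeDivisor T, (Q.asIdeal.under R).height ≤ 1) (G : WeilDivisor R)

/-- The inclusion `R(G) → T(h^*G)`. -/
def inclusionPullback : fractionalIdeal K G →+ fractionalIdeal L (pullback T G) where
  toFun x := ⟨_, map_mem_fractionalIdeal_pullback (L := L) hht x.2⟩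
  map_zero' := Subtype.ext (map_zero _)
  map_add' _ _ := Subtype.ext (map_add _ _ _)

theorem inclusionPullback_smul (r : R) (x : fractionalIdeal K G) :
    inclusionPullback L hht G (r • x) = algebraMap R T r • inclusionPullback L hht G x := by
  refine Subtype.ext ?_
  change IsFractionRing.map _ (r • (x : K)) = _ • IsFractionRing.map _ (x : K)
  rw [Algebra.smul_def, Algebra.smul_def, map_mul, IsFractionRing.map, IsLocalization.map_eq]

/-- The map `Hom_T(F^e_* T(h^*G), T) → Hom_R(F^e_* R(G), R)` defined by a retraction `ρ : T → R`:
restrict to `F^e_* R(G)`, then apply `ρ`. -/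
def nu (ρ : T →ₐ[R] R) (p e : ℕ) [ExpChar R p] [ExpChar T p] :
    (FrobPush p e (fractionalIdeal L (pullback T G)) →ₗ[T] T) →ₗ[R]
      (FrobPush p e (fractionalIdeal K G) →ₗ[R] R) where
  toFun ψ :=
    { toFun := fun x =>
        ρ (ψ (FrobPush.of p e (inclusionPullback L hht G ((FrobPush.of p e).symm x))))
      map_add' := fun x y => by simp only [map_add]
      map_smul' := fun r x => by
        obtain ⟨x, rfl⟩ := (FrobPush.of p e).surjective x
        rw [FrobPush.smul_of, AddEquiv.symm_apply_apply, AddEquiv.symm_apply_apply,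
          inclusionPullback_smul, map_pow, ← FrobPush.smul_of, map_smul, smul_eq_mul, map_mul,
          AlgHom.commutes]
        rfl }
  map_add' ψ₁ ψ₂ := by
    ext x
    simp
  map_smul' r ψ := by
    ext x
    simp

variable {L hht G} in
theorem nu_apply {ρ : T →ₐ[R] R} {p e : ℕ} [ExpChar R p] [ExpChar T p]
    (ψ : FrobPush p e (fractionalIdeal L (pullback T G)) →ₗ[T] T) (x : fractionalIdeal K G) :
    nu L hht G ρ p e ψ (FrobPush.of p e x) =
      ρ (ψ (FrobPush.of p e (inclusionPullback L hht G x))) :=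
  rfl

end Nu

/-- Effectivity of `G` puts `1` in `R(G)`, so `φ` extends to `Φ` on `K`. Elements of `R(G)` become
constant polynomials under `τ`, so the degree zero part of `ψ` on them is `Φ`, that is `φ`. -/
theorem nu_degreeZero_surjective {R : Type*} [CommRing R] [IsDomain R] [IsNoetherianRing R]
    [IsIntegrallyClosed R] {K : Type*} [Field K] [Algebra R K] [IsFractionRing R K]
    (D : WeilDivisor R) [IsNoetherianRing (reesAlgebra K D)] [IsIntegrallyClosed (reesAlgebra K D)]
    (L : Type*) [Field L] [Algebra (reesAlgebra K D) L] [IsFractionRing (reesAlgebra K D) L]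
    {G : WeilDivisor R} (hG : 0 ≤ G) (p e : ℕ) [ExpChar R p] :
    Function.Surjective (nu (K := K) L height_under_le_one G (degreeZero K D) p e) := by
  intro φ
  have h1 : (1 : K) ∈ fractionalIdeal K G := by
    simpa using algebraMap_mem_fractionalIdeal (K := K) hG (1 : R)
  obtain ⟨Φ, hΦ, hφ⟩ := exists_extension_to_fractionField (fractionalIdeal K G).subtype
    Subtype.val_injective (m₀ := ⟨1, h1⟩) rfl φ
  obtain ⟨τ, hτ, hτC⟩ := exists_linearMap_polynomial K D L G
  obtain ⟨ψ, hψ⟩ := exists_linearMap_reesAlgebra (D := D) (G := G) hΦ (fun x hx => by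
      have h := hφ ⟨x, hx⟩
      rw [Submodule.subtype_apply] at h
      rw [h]
      exact algebraMap_mem_fractionalIdeal le_rfl _) τ hτ
  refine ⟨ψ, LinearMap.ext fun x => IsFractionRing.injective R K ?_⟩
  obtain ⟨x, rfl⟩ := (FrobPush.of p e).surjective x
  rw [nu_apply, hψ, hτC x x.2 _ rfl, coeff_C_zero, ← hφ, Submodule.subtype_apply]

end SymbolicRees

end

/-! ### The commutative diagram -/

open SymbolicRees in
theorem proposition3p3
    {R : Type*} [CommRing R] [IsDomain R] [IsNoetherianRing R] [IsIntegrallyClosed R]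
    (p : ℕ) [Fact p.Prime] [CharP R p] (hF : IsFFinite p R)
    {K : Type*} [Field K] [Algebra R K] [IsFractionRing R K]
    (D : WeilDivisor R) (hS : Algebra.FiniteType R (reesAlgebra K D))
    {L : Type*} [Field L] [Algebra (reesAlgebra K D) L] [IsFractionRing (reesAlgebra K D) L]
    (G : WeilDivisor R) (hG : 0 ≤ G) (e : ℕ) :
    IsFFinite p (reesAlgebra K D) ∧
    -- the pullback of divisors from `Spec R` to `Spec S` is well behaved
    (∀ Q : PrimeDivisor (reesAlgebra K D), (Q.asIdeal.under R).height ≤ 1) ∧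
    -- `S` is a Noetherian normal domain, and `R(G) ⊆ K` lands in `S(G_S) ⊆ L`
    ∃ (_ : IsNoetherianRing (reesAlgebra K D)) (_ : IsIntegrallyClosed (reesAlgebra K D))
      (hκ : ∀ x ∈ fractionalIdeal K G,
        IsFractionRing.map (L := L) (FaithfulSMul.algebraMap_injective R (reesAlgebra K D)) x ∈
          fractionalIdeal L (pullback (reesAlgebra K D) G))
      (ν : (FrobPush p e (fractionalIdeal L (pullback (reesAlgebra K D) G))
              →ₗ[reesAlgebra K D] reesAlgebra K D) →ₗ[R]
            (FrobPush p e (fractionalIdeal K G) →ₗ[R] R)),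
      -- `ν` restricts to degree zero and then projects onto degree zero
      (∀ ψ (x : fractionalIdeal K G),
        ν ψ (FrobPush.of p e x) = degreeZero K D (ψ (FrobPush.of p e ⟨_, hκ x x.2⟩))) ∧
      -- the left horizontal maps are injective
      Function.Injective (restrict p e L (pullback_nonneg (reesAlgebra K D) hG)) ∧
      Function.Injective (restrict p e K hG) ∧
      -- the left square commutes
      (∀ ψ, restrict p e K hG (ν ψ) =
        gamma K D p e (restrict p e L (pullback_nonneg (reesAlgebra K D) hG) ψ)) ∧
      -- the right square commutes
      (∀ ψ : FrobPush p e (reesAlgebra K D) →ₗ[reesAlgebra K D] reesAlgebra K D,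
        evalOne p e (gamma K D p e ψ) = degreeZero K D (evalOne p e ψ)) ∧
      Function.Surjective (gamma K D p e) ∧
      Function.Surjective ν := by
  have hN : IsNoetherianRing (reesAlgebra K D) := Algebra.FiniteType.isNoetherianRing R _
  have hI : IsIntegrallyClosed (reesAlgebra K D) := isIntegrallyClosed_reesAlgebra K D
  refine ⟨hF.of_finiteType, height_under_le_one, hN, hI,
    fun x hx => map_mem_fractionalIdeal_pullback height_under_le_one hx,
    nu L height_under_le_one G (degreeZero K D) p e,
    fun ψ x => rfl, restrict_injective p e L _, restrict_injective p e K hG, fun ψ => ?_,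
    fun ψ => ?_, gamma_surjective, nu_degreeZero_surjective D L hG p e⟩
  · refine LinearMap.ext fun x => ?_
    obtain ⟨x, rfl⟩ := (FrobPush.of p e).surjective x
    change degreeZero K D (ψ (FrobPush.of p e _)) = degreeZero K D (ψ (FrobPush.of p e _))
    refine congrArg (fun y => degreeZero K D (ψ (FrobPush.of p e y))) (Subtype.ext ?_)
    -- The routes `R → K → L` and `R → S → L` agree, so both composites evaluate `ψ` at the same
    -- element.
    exact IsLocalization.map_eq _ x
  · change degreeZero K D (ψ (FrobPush.of p e (algebraMap R (reesAlgebra K D) 1))) =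
      degreeZero K D (ψ (FrobPush.of p e 1))
    rw [map_one]
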